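/- Let $(\Omega,\mathcal F,\mathbb P,(\theta_t)_{t\in\mathbb R})$ be a metric dynamical system (a probability space with a jointly measurable flow of $\mathbb P$-preserving maps), let $X$ be a compact metric space, and let $\varphi$ be a random dynamical system on $X$ over $\theta$, i.e. a jointly measurable map $\varphi:\mathbb R\times\Omega\times X\to X$ with each $\varphi(t,\omega)$ continuous, $\varphi(0,\omega)=\mathrm{id}_X$ and $\varphi(t+s,\omega)=\varphi(t,\theta_s\omega)\circ\varphi(s,\omega)$. A random open set is a family $(U(\omega))_{\omega\in\Omega}$ of open subsets of $X$ such that $\omega\mapsto \mathrm{dist}(x,X\setminus U(\omega))$ is $\mathcal F$-measurable for every $x\in X$ (with $\mathrm{dist}(x,\emptyset)=\infty$). A family $D$ is invariant if $\varphi(t,\omega)D(\omega)=D(\theta_t\omega)$ for all $t\in\mathbb R$, $\omega\in\Omega$. A random pre-attractor is a random open set $U$ for which there is a random variable $T(\omega)>0$ with $$\overline{\bigcup_{t\ge T(\omega)}\varphi(t,\theta_{-t}\omega)U(\theta_{-t}\omega)}\subset U(\omega)\quad\text{almost surely};$$ it determines the random local attractor $A$ if, almost surely, $$A(\omega)=\Omega_U(\omega):=\bigcap_{T\ge0}\overline{\bigcup_{t\ge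 T}\varphi(t,\theta_{-t}\omega)U(\theta_{-t}\omega)}.$$ A random local attractor is a family $A$ determined in this way by some random pre-attractor. The random basin of $A$, computed from a random pre-attractor $U$ determining $A$, is $$B(A)(\omega)=\{x\in X:\ \varphi(t,\omega)x\in U(\theta_t\omega)\text{ for some }t\ge0\}.$$ Then for every random local attractor $A$ the random basin $B(A)$ is, up to a null set, an invariant random open set. Precisely: there is an invariant random open set $B$ such that for every random pre-attractor $U$ determining $A$ there is a $\theta$-invariant set $\Omega_0\in\mathcal F$ with $\mathbb P(\Omega_0)=1$ such that the basin computed from $U$ equals $B(\omega)$ for all $\omega\in\Omega_0$. -/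

import Mathlib

open MeasureTheory Set

/-- A metric dynamical system with two-sided continuous time on the measure space `(Ω, P)`:
a jointly measurable flow of measure-preserving maps. -/
structure MetricDS {Ω : Type*} [MeasurableSpace Ω] (P : Measure Ω) where
  θ : ℝ → Ω → Ω
  measurable_θ : Measurable (fun p : ℝ × Ω => θ p.1 p.2)
  zero : ∀ ω, θ 0 ω = ω
  add : ∀ s t ω, θ (t + s) ω = θ t (θ s ω)
  preserving : ∀ t, MeasurePreserving (θ t) P P

/-- A random dynamical system on `X` over the metric dynamical system `S`: a jointly measurable
cocycle of continuous maps of `X`. -/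
structure RDS {Ω : Type*} [MeasurableSpace Ω] {P : Measure Ω} (S : MetricDS P)
    (X : Type*) [TopologicalSpace X] [MeasurableSpace X] where
  φ : ℝ → Ω → X → X
  measurable_φ : Measurable (fun p : ℝ × Ω × X => φ p.1 p.2.1 p.2.2)
  continuous_φ : ∀ t ω, Continuous (φ t ω)
  zero : ∀ ω x, φ 0 ω x = x
  cocycle : ∀ s t ω x, φ (t + s) ω x = φ t (S.θ s ω) (φ s ω x)

/-- Random closed sets. The distance to the empty set is `∞`. -/
def IsRandomClosedSet {Ω X : Type*} [MeasurableSpace Ω] [MetricSpace X]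
    (D : Ω → Set X) : Prop :=
  (∀ ω, IsClosed (D ω)) ∧ ∀ x : X, Measurable (fun ω => Metric.infEDist x (D ω))

/-- Random open sets: the complement is a random closed set. -/
def IsRandomOpenSet {Ω X : Type*} [MeasurableSpace Ω] [MetricSpace X]
    (U : Ω → Set X) : Prop :=
  (∀ ω, IsOpen (U ω)) ∧ IsRandomClosedSet (fun ω => (U ω)ᶜ)

namespace RDS

variable {Ω X : Type*} [MeasurableSpace Ω] {P : Measure Ω} {S : MetricDS P}

/-- `closure (⋃_{t ≥ T} φ(t, θ_{-t} ω) D(θ_{-t} ω))` -/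
def pullbackTail [TopologicalSpace X] [MeasurableSpace X] (Φ : RDS S X)
    (D : Ω → Set X) (T : ℝ) (ω : Ω) : Set X :=
  closure (⋃ t ∈ Ici T, Φ.φ t (S.θ (-t) ω) '' D (S.θ (-t) ω))

/-- The (pull-back) omega-limit set of `D`. -/
def omegaLimitSet [TopologicalSpace X] [MeasurableSpace X] (Φ : RDS S X)
    (D : Ω → Set X) (ω : Ω) : Set X :=
  ⋂ T ∈ Ici (0 : ℝ), Φ.pullbackTail D T ω

/-- Invariance: `φ(t, ω) D(ω) = D(θ_t ω)` for all times `t` and all `ω`. -/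
def IsInvariant [TopologicalSpace X] [MeasurableSpace X] (Φ : RDS S X)
    (D : Ω → Set X) : Prop :=
  ∀ t ω, Φ.φ t ω '' D ω = D (S.θ t ω)

/-- Random pre-attractors: random open sets `U` such that, for some random time `T(ω) > 0`,
almost surely `closure (⋃_{t ≥ T(ω)} φ(t, θ_{-t} ω) U(θ_{-t} ω)) ⊆ U(ω)`. -/
def IsPreAttractor [MetricSpace X] [MeasurableSpace X] (Φ : RDS S X)
    (U : Ω → Set X) : Prop :=
  IsRandomOpenSet U ∧ ∃ T : Ω → ℝ, Measurable T ∧ (∀ ω, 0 < T ω) ∧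
    ∀ᵐ ω ∂P, Φ.pullbackTail U (T ω) ω ⊆ U ω

/-- `U` is a random pre-attractor and `A` is (almost surely) the random local attractor
inside `U`. -/
def Determines [MetricSpace X] [MeasurableSpace X] (Φ : RDS S X)
    (U A : Ω → Set X) : Prop :=
  Φ.IsPreAttractor U ∧ ∀ᵐ ω ∂P, A ω = Φ.omegaLimitSet U ω

/-- Random local attractors. -/
def IsLocalAttractor [MetricSpace X] [MeasurableSpace X] (Φ : RDS S X)
    (A : Ω → Set X) : Prop :=
  ∃ U : Ω → Set X, Φ.Determines U A

/-- The random basin computed from the pre-attractor `U`: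
`{x | φ(t, ω) x ∈ U(θ_t ω) for some t ≥ 0}`. -/
def basin [TopologicalSpace X] [MeasurableSpace X] (Φ : RDS S X)
    (U : Ω → Set X) (ω : Ω) : Set X :=
  {x | ∃ t : ℝ, 0 ≤ t ∧ Φ.φ t ω x ∈ U (S.θ t ω)}

end RDS

/-! The basin is an uncountable union over `t`, so neither measurability nor invariance is
automatic. The remedy is to replace "for some `t ≥ 0`" by "for a set of `t` of positive Lebesgue
measure".

Let `G n` be measurable sets on which the pullback tail from time `n` lies in `U`, covering almost
every `ω`. By Poincaré recurrence (`measure_recurrentSet`), almost every `ω` spends positive time in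
one fixed `G n` after every moment; such `ω` form an invariant set. For them, an orbit in `U` at
time `r` is in `U` at every `t ≥ r + n` with `θ_t ω ∈ G n`. This yields invariance and identifies
the basin with the nonvanishing set of `occupation`, which is measurable in `ω` and continuous in
`x`, hence with a random open set.

If two pre-attractors determine the same attractor, compactness puts a pullback tail of each inside
the other, and recurrence then gives both inclusions of basins (`basin_subset_basin`). -/

theorem IsOpen.infEDist_compl_ne_zero_iff {X : Type*} [MetricSpace X] {U : Set X}
    (hU : IsOpen U) (x : X) : Metric.infEDist x Uᶜ ≠ 0 ↔ x ∈ U := by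
  rw [Ne, ← Metric.mem_iff_infEDist_zero_of_closed hU.isClosed_compl, notMem_compl_iff]

theorem IsRandomOpenSet.measurable_infEDist_compl {α Ω X : Type*} [MeasurableSpace α]
    [MeasurableSpace Ω] [MetricSpace X] [CompactSpace X] [MeasurableSpace X] [BorelSpace X]
    {U : Ω → Set X} (hU : IsRandomOpenSet U) {f : α → Ω} {g : α → X} (hf : Measurable f)
    (hg : Measurable g) : Measurable (fun a => Metric.infEDist (g a) (U (f a))ᶜ) := by
  have h := (measurable_uncurry_of_continuous_of_measurable
    (u := fun (x : X) (ω : Ω) => Metric.infEDist x (U ω)ᶜ)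
    (fun ω => Metric.continuous_infEDist) (fun x => hU.2.2 x)).comp (hg.prodMk hf)
  simpa only [Function.comp_def, Function.uncurry_apply_pair] using h

/-- The nonvanishing set of a Carathéodory function is a random open set. -/
theorem isRandomOpenSet_of_caratheodory {Ω X : Type*} [MeasurableSpace Ω] [MetricSpace X]
    [CompactSpace X] {F : Ω → X → ENNReal} (hc : ∀ ω, Continuous (F ω))
    (hm : ∀ x, Measurable (fun ω => F ω x)) : IsRandomOpenSet (fun ω => {x | F ω x ≠ 0}) := by
  have hcl : ∀ ω, IsClosed {x | F ω x = 0} := fun ω => isClosed_eq (hc ω) continuous_const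
  have hcompl : ∀ ω, {x | F ω x ≠ 0}ᶜ = {x | F ω x = 0} := fun ω => by ext; simp
  refine ⟨fun ω => (hcl ω).isOpen_compl, fun ω => by simpa only [hcompl] using hcl ω,
    fun x => measurable_of_Iic fun q => ?_⟩
  simp only [hcompl]
  have : Nonempty X := ⟨x⟩
  rcases eq_or_ne q ⊤ with rfl | hq
  · simp
  -- By compactness, a zero within distance `q` exists iff for every `m` some point has both defects
  -- at most `1/(m+1)`; strict inequalities are open, so a countable dense set suffices.
  have key : (fun ω => Metric.infEDist x {x | F ω x = 0}) ⁻¹' Iic q =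
      ⋂ m : ℕ, ⋃ i : ℕ, {ω | edist x (TopologicalSpace.denseSeq X i) < q + (m + 1 : ENNReal)⁻¹ ∧
        F ω (TopologicalSpace.denseSeq X i) < (m + 1 : ENNReal)⁻¹} := by
    ext ω
    simp only [mem_preimage, mem_Iic, mem_iInter, mem_iUnion, mem_ofPred_eq]
    constructor
    · intro h m
      have hne : {x | F ω x = 0}.Nonempty := by
        by_contra hne
        rw [not_nonempty_iff_eq_empty] at hne
        rw [hne, Metric.infEDist_empty, top_le_iff] at h
        exact hq h
      obtain ⟨y, hy, hxy⟩ := (hcl ω).isCompact.exists_infEDist_eq_edist hne x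
      rw [hxy] at h
      have hpos : (0 : ENNReal) < (m + 1 : ENNReal)⁻¹ := by simp
      have ho : IsOpen {z | edist x z < q + (m + 1 : ENNReal)⁻¹ ∧ F ω z < (m + 1 : ENNReal)⁻¹} :=
        (isOpen_lt (continuous_const.edist continuous_id) continuous_const).inter
          (isOpen_lt (hc ω) continuous_const)
      obtain ⟨i, hi⟩ := (TopologicalSpace.denseRange_denseSeq X).exists_mem_open ho
        ⟨y, h.trans_lt (ENNReal.lt_add_right hq hpos.ne'), by
          rw [mem_ofPred_eq] at hy; rwa [hy]⟩
      exact ⟨i, hi⟩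
    · intro h
      have hV := IsCompact.nonempty_iInter_of_sequence_nonempty_isCompact_isClosed
        (fun m : ℕ => {z | edist x z ≤ q + (m + 1 : ENNReal)⁻¹ ∧ F ω z ≤ (m + 1 : ENNReal)⁻¹})
        (fun m z hz => by
          have hle : ((m + 1 : ℕ) + 1 : ENNReal)⁻¹ ≤ (m + 1 : ENNReal)⁻¹ := by
            rw [ENNReal.inv_le_inv]; push_cast; exact le_self_add
          exact ⟨hz.1.trans (by gcongr), hz.2.trans hle⟩)
        (fun m => by obtain ⟨i, hi⟩ := h m; exact ⟨_, hi.1.le, hi.2.le⟩)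
        (IsClosed.isCompact ((isClosed_le (continuous_const.edist continuous_id)
          continuous_const).inter (isClosed_le (hc ω) continuous_const)))
        (fun m => (isClosed_le (continuous_const.edist continuous_id)
          continuous_const).inter (isClosed_le (hc ω) continuous_const))
      obtain ⟨z, hz⟩ := hV
      rw [mem_iInter] at hz
      have hlim : Filter.Tendsto (fun m : ℕ => (m + 1 : ENNReal)⁻¹) Filter.atTop (nhds 0) := by
        have := (Filter.tendsto_add_atTop_iff_nat 1).2 ENNReal.tendsto_inv_nat_nhds_zero
        simpa using this
      have hFz : F ω z = 0 := le_antisymm (ge_of_tendsto' hlim fun m => (hz m).2) zero_le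
      have hlim' := hlim.const_add q
      rw [add_zero] at hlim'
      exact (Metric.infEDist_le_edist_of_mem (s := {x | F ω x = 0}) hFz).trans (ge_of_tendsto' hlim' fun m => (hz m).1)
  rw [key]
  refine MeasurableSet.iInter fun m => MeasurableSet.iUnion fun i => ?_
  exact (MeasurableSet.const _).inter (measurableSet_lt (hm _) measurable_const)

/-! ### Recurrence in the base flow. -/

namespace MetricDS

variable {Ω : Type*} [MeasurableSpace Ω] {P : Measure Ω} (S : MetricDS P)

theorem measurable_θ_comp {α : Type*} [MeasurableSpace α] {f : α → ℝ} {g : α → Ω}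
    (hf : Measurable f) (hg : Measurable g) : Measurable (fun a => S.θ (f a) (g a)) :=
  S.measurable_θ.comp (hf.prodMk hg)

theorem θ_neg_θ (t : ℝ) (ω : Ω) : S.θ (-t) (S.θ t ω) = ω := by
  rw [← S.add, neg_add_cancel, S.zero]

theorem iterate_θ_one (k : ℕ) (ω : Ω) : (S.θ 1)^[k] ω = S.θ k ω := by
  induction k with
  | zero => simp [S.zero]
  | succ k ih => rw [Function.iterate_succ_apply', ih, ← S.add, Nat.cast_succ, add_comm]

/-- The points whose forward orbit spends a positive amount of time after every moment in
some fixed `G n`. -/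
def recurrentSet (G : ℕ → Set Ω) : Set Ω :=
  {ω | ∃ n, ∀ a : ℝ, 0 < volume {t | a ≤ t ∧ S.θ t ω ∈ G n}}

theorem measurableSet_recurrentSet {G : ℕ → Set Ω} (hG : ∀ n, MeasurableSet (G n)) :
    MeasurableSet (S.recurrentSet G) := by
  have : S.recurrentSet G =
      ⋃ n, ⋂ a : ℕ, {ω | 0 < volume {t | (a : ℝ) ≤ t ∧ S.θ t ω ∈ G n}} := by
    ext ω
    simp only [recurrentSet, mem_ofPred_eq, mem_iUnion, mem_iInter]
    refine exists_congr fun n => ⟨fun h a => h a, fun h a => ?_⟩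
    obtain ⟨k, hk⟩ := exists_nat_ge a
    exact (h k).trans_le (measure_mono fun t ht => ⟨hk.trans ht.1, ht.2⟩)
  rw [this]
  refine MeasurableSet.iUnion fun n => MeasurableSet.iInter fun a => ?_
  have hs : MeasurableSet {p : Ω × ℝ | (a : ℝ) ≤ p.2 ∧ S.θ p.2 p.1 ∈ G n} :=
    (measurableSet_le measurable_const measurable_snd).inter
      (S.measurable_θ_comp measurable_snd measurable_fst (hG n))
  exact measurableSet_lt measurable_const (measurable_measure_prodMk_left (ν := volume) hs)

theorem θ_mem_recurrentSet_iff (G : ℕ → Set Ω) (r : ℝ) (ω : Ω) :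
    S.θ r ω ∈ S.recurrentSet G ↔ ω ∈ S.recurrentSet G := by
  have key : ∀ r ω, ω ∈ S.recurrentSet G → S.θ r ω ∈ S.recurrentSet G := by
    rintro r ω ⟨n, h⟩
    refine ⟨n, fun a => ?_⟩
    have : {t | a ≤ t ∧ S.θ t (S.θ r ω) ∈ G n} =
        (fun t => t + r) ⁻¹' {t | a + r ≤ t ∧ S.θ t ω ∈ G n} := by
      ext t; simp [S.add]
    rw [this, measure_preimage_add_right]
    exact h _
  refine ⟨fun h => ?_, key r ω⟩
  simpa only [S.θ_neg_θ] using key (-r) _ h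

/-- Poincaré recurrence for the time-one map, applied to the `ω` that spend positive time of `[0,
1]` in `G n`. By Fubini almost every `ω` is of this kind for some `n`. -/
theorem measure_recurrentSet [IsProbabilityMeasure P] {G : ℕ → Set Ω}
    (hG : ∀ n, MeasurableSet (G n)) (hae : ∀ᵐ ω ∂P, ∃ n, ω ∈ G n) :
    P (S.recurrentSet G) = 1 := by
  rw [← mem_ae_iff_prob_eq_one (S.measurableSet_recurrentSet hG)]
  have hs : ∀ n, MeasurableSet {p : Ω × ℝ | p.2 ∈ Icc (0 : ℝ) 1 ∧ S.θ p.2 p.1 ∈ G n} := fun n =>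
    (measurable_snd measurableSet_Icc).inter
      (S.measurable_θ_comp measurable_snd measurable_fst (hG n))
  set G' : ℕ → Set Ω := fun n => {ω | 0 < volume {t | t ∈ Icc (0 : ℝ) 1 ∧ S.θ t ω ∈ G n}}
    with hG'
  have hG'm : ∀ n, MeasurableSet (G' n) := fun n =>
    measurableSet_lt measurable_const (measurable_measure_prodMk_left (ν := volume) (hs n))
  have h1 : ∀ᵐ ω ∂P, ∀ n, ω ∈ G' n → ∃ᶠ k in Filter.atTop, (S.θ 1)^[k] ω ∈ G' n :=
    ae_all_iff.2 fun n => (S.preserving 1).conservative.ae_mem_imp_frequently_image_mem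
      (hG'm n).nullMeasurableSet
  have hU : MeasurableSet (⋃ n, G n) := MeasurableSet.iUnion hG
  have h2 : ∀ᵐ ω ∂P, ∀ᵐ t ∂(volume : Measure ℝ), S.θ t ω ∈ ⋃ n, G n := by
    rw [Measure.ae_ae_comm (p := fun ω t => S.θ t ω ∈ ⋃ n, G n)
      (S.measurable_θ_comp measurable_snd measurable_fst hU)]
    refine Filter.Eventually.of_forall fun t => (S.preserving t).quasiMeasurePreserving.ae ?_
    filter_upwards [hae] with ω hω using mem_iUnion.2 hω
  filter_upwards [h1, h2] with ω hω1 hω2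
  obtain ⟨n, hn⟩ : ∃ n, ω ∈ G' n := by
    by_contra! hno
    have h0 : volume (⋃ n, {t | t ∈ Icc (0 : ℝ) 1 ∧ S.θ t ω ∈ G n}) = 0 :=
      measure_iUnion_null fun n => by simpa [hG'] using hno n
    have : volume (Icc (0 : ℝ) 1) ≤ 0 := by
      rw [← h0]
      refine measure_mono_ae ?_
      filter_upwards [hω2] with t ht ht'
      obtain ⟨n, hn⟩ := mem_iUnion.1 ht
      exact mem_iUnion.2 ⟨n, ht', hn⟩
    simp at this
  refine ⟨n, fun a => ?_⟩
  obtain ⟨m, hm⟩ := exists_nat_ge a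
  obtain ⟨k, hk, hkG⟩ := (Filter.frequently_atTop.1 (hω1 n hn)) m
  rw [S.iterate_θ_one] at hkG
  have hkG' : 0 < volume {t | t ∈ Icc (0 : ℝ) 1 ∧ S.θ t (S.θ k ω) ∈ G n} := hkG
  rw [← measure_preimage_add_right volume (-(k : ℝ))] at hkG'
  refine hkG'.trans_le (measure_mono fun t ht => ?_)
  have hmk : (m : ℝ) ≤ k := by exact_mod_cast hk
  obtain ⟨⟨h0, -⟩, hG0⟩ := ht
  rw [← S.add, neg_add_cancel_right] at hG0
  exact ⟨by linarith, hG0⟩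

end MetricDS

/-! ### Basins along recurrent orbits. -/

namespace RDS

variable {Ω X : Type*} [MeasurableSpace Ω] {P : Measure Ω} {S : MetricDS P}

section Topological

variable [TopologicalSpace X] [MeasurableSpace X] (Φ : RDS S X)

theorem measurable_φ_comp {α : Type*} [MeasurableSpace α] {f : α → ℝ} {g : α → Ω} {h : α → X}
    (hf : Measurable f) (hg : Measurable g) (hh : Measurable h) :
    Measurable (fun a => Φ.φ (f a) (g a) (h a)) :=
  Φ.measurable_φ.comp (hf.prodMk (hg.prodMk hh))

theorem φ_φ_neg (t : ℝ) (ω : Ω) (x : X) : Φ.φ t ω (Φ.φ (-t) (S.θ t ω) x) = x := by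
  have h := Φ.cocycle (-t) t (S.θ t ω) x
  rw [add_neg_cancel, Φ.zero, S.θ_neg_θ] at h
  exact h.symm

theorem φ_sub (r t : ℝ) (ω : Ω) (x : X) :
    Φ.φ (t - r) (S.θ r ω) (Φ.φ r ω x) = Φ.φ t ω x := by
  rw [← Φ.cocycle, sub_add_cancel]

theorem pullbackTail_antitone (D : Ω → Set X) (ω : Ω) :
    Antitone (fun T => Φ.pullbackTail D T ω) := fun _ _ h =>
  closure_mono (biUnion_subset_biUnion_left (Ici_subset_Ici.2 h))

theorem φ_mem_pullbackTail {D : Ω → Set X} {T t r : ℝ} {ω : Ω} {x : X} (h : T ≤ t - r)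
    (hx : Φ.φ r ω x ∈ D (S.θ r ω)) : Φ.φ t ω x ∈ Φ.pullbackTail D T (S.θ t ω) := by
  refine subset_closure (mem_biUnion (mem_Ici.2 h) ?_)
  rw [← S.add, neg_sub, sub_add_cancel]
  exact ⟨_, hx, Φ.φ_sub r t ω x⟩

/-- On the recurrent set of a family absorbing the pullback tails of `U`, the orbits of points of
the basin keep spending time in `U`. -/
theorem measure_pos_of_mem_basin {U : Ω → Set X} {G : ℕ → Set Ω}
    (hG : ∀ n, ∀ ω ∈ G n, Φ.pullbackTail U n ω ⊆ U ω) {ω : Ω} (hω : ω ∈ S.recurrentSet G)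
    {x : X} (hx : x ∈ Φ.basin U ω) (a : ℝ) :
    0 < volume {t | a ≤ t ∧ Φ.φ t ω x ∈ U (S.θ t ω)} := by
  obtain ⟨r, -, hr⟩ := hx
  obtain ⟨n, hn⟩ := hω
  refine (hn (max a (n + r))).trans_le (measure_mono fun t ht => ⟨(le_max_left _ _).trans ht.1, ?_⟩)
  exact hG n _ ht.2 (Φ.φ_mem_pullbackTail (le_sub_iff_add_le.2 ((le_max_right _ _).trans ht.1)) hr)

theorem φ_mem_basin {U : Ω → Set X} {ω : Ω} {x : X}
    (h : ∀ a : ℝ, 0 < volume {t | a ≤ t ∧ Φ.φ t ω x ∈ U (S.θ t ω)}) (r : ℝ) :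
    Φ.φ r ω x ∈ Φ.basin U (S.θ r ω) := by
  obtain ⟨t, ht, hU⟩ := nonempty_of_measure_ne_zero (h r).ne'
  refine ⟨t - r, sub_nonneg.2 ht, ?_⟩
  rwa [Φ.φ_sub, ← S.add, sub_add_cancel]

theorem image_basin {U : Ω → Set X} {G : ℕ → Set Ω}
    (hG : ∀ n, ∀ ω ∈ G n, Φ.pullbackTail U n ω ⊆ U ω) {ω : Ω} (hω : ω ∈ S.recurrentSet G)
    (r : ℝ) : Φ.φ r ω '' Φ.basin U ω = Φ.basin U (S.θ r ω) := by
  refine Subset.antisymm ?_ fun y hy => ?_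
  · rintro _ ⟨x, hx, rfl⟩
    exact Φ.φ_mem_basin (Φ.measure_pos_of_mem_basin hG hω hx) r
  · have h := Φ.φ_mem_basin (Φ.measure_pos_of_mem_basin hG
      ((S.θ_mem_recurrentSet_iff G r ω).2 hω) hy) (-r)
    rw [S.θ_neg_θ] at h
    exact ⟨_, h, Φ.φ_φ_neg r ω y⟩

/-- Since `hE` controls only almost every `s`, a single visit to `U` is not enough; recurrence in
`G` supplies a positive measure of visits, one of which avoids the exceptional null set. -/
theorem basin_subset_basin {U U' : Ω → Set X} {G E : ℕ → Set Ω}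
    (hG : ∀ n, ∀ ω ∈ G n, Φ.pullbackTail U n ω ⊆ U ω)
    (hE : ∀ n, ∀ ω ∈ E n, ∀ᵐ s : ℝ, n ≤ s → ∀ y ∈ U (S.θ (-s) ω),
      Φ.φ s (S.θ (-s) ω) y ∈ U' ω)
    {ω : Ω} (hωG : ω ∈ S.recurrentSet G) (hωE : ω ∈ S.recurrentSet E) :
    Φ.basin U ω ⊆ Φ.basin U' ω := by
  intro x hx
  have hJ := Φ.measure_pos_of_mem_basin hG hωG hx 0
  -- Bounding the visits by `b` lets one `t ≥ b + n` satisfy `n ≤ t - r` for all of them.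
  obtain ⟨b, hb⟩ : ∃ b : ℕ, 0 < volume {t : ℝ | t ≤ b ∧ 0 ≤ t ∧ Φ.φ t ω x ∈ U (S.θ t ω)} := by
    by_contra! hno
    have h0 : volume (⋃ b : ℕ, {t : ℝ | t ≤ b ∧ 0 ≤ t ∧ Φ.φ t ω x ∈ U (S.θ t ω)}) = 0 :=
      measure_iUnion_null fun b => le_antisymm (hno b) zero_le
    refine hJ.ne' (measure_mono_null (fun t ht => ?_) h0)
    obtain ⟨b, hb⟩ := exists_nat_ge t
    exact mem_iUnion.2 ⟨b, hb, ht⟩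
  obtain ⟨n, hn⟩ := hωE
  obtain ⟨t, ht, htE⟩ := nonempty_of_measure_ne_zero (hn (b + n)).ne'
  have hae : ∀ᵐ r : ℝ, n ≤ t - r → ∀ y ∈ U (S.θ r ω), Φ.φ (t - r) (S.θ r ω) y ∈ U' (S.θ t ω) := by
    have := (Measure.measurePreserving_sub_left volume t).quasiMeasurePreserving.ae (hE n _ htE)
    filter_upwards [this] with r hr
    rwa [← S.add, neg_sub, sub_add_cancel] at hr
  obtain ⟨r, ⟨hrb, hr0, hrU⟩, hr⟩ :=
    ((frequently_ae_mem_iff.2 hb.ne').and_eventually hae).exists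
  refine ⟨t, ?_, ?_⟩
  · have : (0 : ℝ) ≤ n := n.cast_nonneg
    linarith
  · have := hr (by linarith) _ hrU
    rwa [Φ.φ_sub] at this

end Topological

/-! ### Absorption between pre-attractors. -/

variable [MetricSpace X] [MeasurableSpace X] (Φ : RDS S X)

theorem exists_absorbing {U : Ω → Set X} (hU : Φ.IsPreAttractor U) :
    ∃ G : ℕ → Set Ω, (∀ n, MeasurableSet (G n)) ∧ (∀ᵐ ω ∂P, ∃ n, ω ∈ G n) ∧
      ∀ n, ∀ ω ∈ G n, Φ.pullbackTail U n ω ⊆ U ω := by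
  obtain ⟨-, T, hT, -, hae⟩ := hU
  obtain ⟨M, hM, hMm, hMs⟩ := hae.exists_measurable_mem
  refine ⟨fun n => {ω | T ω ≤ n} ∩ M, fun n => (measurableSet_le hT measurable_const).inter hMm,
    ?_, fun n ω hω => (Φ.pullbackTail_antitone U ω hω.1).trans (hMs ω hω.2)⟩
  filter_upwards [hM] with ω hω
  obtain ⟨n, hn⟩ := exists_nat_ge (T ω)
  exact ⟨n, hn, hω⟩

/-- The tails are compact and decrease to `A ω`, which lies in the open set `U' ω`. -/
theorem ae_exists_pullbackTail_subset [CompactSpace X] {U U' A : Ω → Set X} (hU : Φ.Determines U A)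
    (hU' : Φ.Determines U' A) : ∀ᵐ ω ∂P, ∃ n : ℕ, Φ.pullbackTail U n ω ⊆ U' ω := by
  obtain ⟨⟨hUo', T, -, hTpos, hT⟩, hA'⟩ := hU'
  filter_upwards [hU.2, hA', hT] with ω h1 h2 h3
  refine exists_subset_nhds_of_isCompact (V := fun n : ℕ => Φ.pullbackTail U n ω) ?_
    (fun n => isClosed_closure.isCompact) fun x hx => (hUo'.1 ω).mem_nhds ?_
  · exact Antitone.directed_ge fun m n h => Φ.pullbackTail_antitone U ω (Nat.cast_le.2 h)
  · have hxA : x ∈ A ω := by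
      rw [h1]
      refine mem_iInter₂.2 fun T _ => ?_
      obtain ⟨n, hn⟩ := exists_nat_ge T
      exact Φ.pullbackTail_antitone U ω hn (mem_iInter.1 hx n)
    rw [h2] at hxA
    exact h3 (mem_iInter₂.1 hxA (T ω) (hTpos ω).le)

variable [CompactSpace X] [BorelSpace X]

theorem measurableSet_image_subset {U U' : Ω → Set X} (hU : IsRandomOpenSet U)
    (hU' : IsRandomOpenSet U') :
    MeasurableSet {p : Ω × ℝ | ∀ y ∈ U (S.θ (-p.2) p.1),
      Φ.φ p.2 (S.θ (-p.2) p.1) y ∈ U' p.1} := by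
  rcases isEmpty_or_nonempty X with hX | hX
  · simp
  set f : Ω × ℝ → X → ENNReal := fun p y => Metric.infEDist y (U (S.θ (-p.2) p.1))ᶜ with hf
  set g : Ω × ℝ → X → ENNReal := fun p y =>
    Metric.infEDist (Φ.φ p.2 (S.θ (-p.2) p.1) y) (U' p.1)ᶜ with hg
  have hθ : Measurable fun p : Ω × ℝ => S.θ (-p.2) p.1 :=
    S.measurable_θ_comp measurable_snd.neg measurable_fst
  have hfc : ∀ p, Continuous (f p) := fun p => Metric.continuous_infEDist
  have hgc : ∀ p, Continuous (g p) := fun p =>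
    Metric.continuous_infEDist.comp (Φ.continuous_φ _ _)
  have hfm : ∀ y, Measurable fun p => f p y := fun y =>
    hU.measurable_infEDist_compl hθ measurable_const
  have hgm : ∀ y, Measurable fun p => g p y := fun y =>
    hU'.measurable_infEDist_compl measurable_fst
      (Φ.measurable_φ_comp measurable_snd hθ measurable_const)
  -- `{f p ≠ 0}` is exhausted by the compact sets `{1/k ≤ f p}`, on each of which a nonvanishing `g
  -- p` has a positive minimum.
  have key : {p : Ω × ℝ | ∀ y ∈ U (S.θ (-p.2) p.1), Φ.φ p.2 (S.θ (-p.2) p.1) y ∈ U' p.1} =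
      ⋂ k : ℕ, ⋃ m : ℕ, ⋂ i : ℕ,
        ({p | f p (TopologicalSpace.denseSeq X i) ≤ (k : ENNReal)⁻¹} ∪
          {p | (m : ENNReal)⁻¹ ≤ g p (TopologicalSpace.denseSeq X i)}) := by
    ext p
    have hfU : ∀ y, f p y ≠ 0 ↔ y ∈ U (S.θ (-p.2) p.1) := fun y =>
      (hU.1 _).infEDist_compl_ne_zero_iff y
    have hgU : ∀ y, g p y ≠ 0 ↔ Φ.φ p.2 (S.θ (-p.2) p.1) y ∈ U' p.1 := fun y =>
      (hU'.1 _).infEDist_compl_ne_zero_iff _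
    simp only [mem_ofPred_eq, ← hfU, ← hgU, mem_iInter, mem_iUnion, mem_union]
    constructor
    · intro h k
      have hK : IsCompact {y | (k : ENNReal)⁻¹ ≤ f p y} :=
        (isClosed_le continuous_const (hfc p)).isCompact
      rcases eq_empty_or_nonempty {y | (k : ENNReal)⁻¹ ≤ f p y} with he | hne
      · refine ⟨0, fun i => Or.inl (le_of_not_ge fun hi => ?_)⟩
        exact (he.subset hi).elim
      · obtain ⟨y, hy, hmin⟩ := hK.exists_isMinOn hne (hgc p).continuousOn
        have hgy : g p y ≠ 0 := h y
          ((ENNReal.inv_pos.2 (ENNReal.natCast_ne_top k)).trans_le hy).ne'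
        obtain ⟨m, hm⟩ := ENNReal.exists_inv_nat_lt hgy
        refine ⟨m, fun i => ?_⟩
        rcases le_total (f p (TopologicalSpace.denseSeq X i)) (k : ENNReal)⁻¹ with hi | hi
        · exact Or.inl hi
        · exact Or.inr (hm.le.trans (hmin hi))
    · intro h y hy hgy
      obtain ⟨k, hk⟩ := ENNReal.exists_inv_nat_lt hy
      obtain ⟨m, hm⟩ := h k
      have ho : IsOpen {z | (k : ENNReal)⁻¹ < f p z ∧ g p z < (m : ENNReal)⁻¹} :=
        (isOpen_lt continuous_const (hfc p)).inter (isOpen_lt (hgc p) continuous_const)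
      obtain ⟨i, hi⟩ := (TopologicalSpace.denseRange_denseSeq X).exists_mem_open ho
        ⟨y, hk, by rw [hgy]; exact ENNReal.inv_pos.2 (ENNReal.natCast_ne_top m)⟩
      exact (hm i).elim (fun h' => h'.not_gt hi.1) fun h' => h'.not_gt hi.2
  rw [key]
  exact MeasurableSet.iInter fun k => MeasurableSet.iUnion fun m => MeasurableSet.iInter fun i =>
    (measurableSet_le (hfm _) measurable_const).union (measurableSet_le measurable_const (hgm _))

/-- Asking for almost every `s` instead of every `s` makes the sets measurable, by Fubini. -/
theorem exists_ae_absorbing {U U' A : Ω → Set X} (hU : Φ.Determines U A)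
    (hU' : Φ.Determines U' A) :
    ∃ E : ℕ → Set Ω, (∀ n, MeasurableSet (E n)) ∧ (∀ᵐ ω ∂P, ∃ n, ω ∈ E n) ∧
      ∀ n, ∀ ω ∈ E n, ∀ᵐ s : ℝ, n ≤ s → ∀ y ∈ U (S.θ (-s) ω), Φ.φ s (S.θ (-s) ω) y ∈ U' ω := by
  refine ⟨fun n => {ω | ∀ᵐ s : ℝ, n ≤ s → ∀ y ∈ U (S.θ (-s) ω), Φ.φ s (S.θ (-s) ω) y ∈ U' ω},
    fun n => ?_, ?_, fun n ω hω => hω⟩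
  · have hs : MeasurableSet {p : Ω × ℝ | n ≤ p.2 → ∀ y ∈ U (S.θ (-p.2) p.1),
        Φ.φ p.2 (S.θ (-p.2) p.1) y ∈ U' p.1} :=
      (measurableSet_le measurable_const measurable_snd).imp
        (Φ.measurableSet_image_subset hU.1.1 hU'.1.1)
    exact measurable_measure_prodMk_left (ν := volume) hs.compl (measurableSet_singleton 0)
  · filter_upwards [Φ.ae_exists_pullbackTail_subset hU hU'] with ω ⟨n, hn⟩
    exact ⟨n, Filter.Eventually.of_forall fun s hs y hy =>
      hn (subset_closure (mem_biUnion (mem_Ici.2 hs) (mem_image_of_mem _ hy)))⟩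

/-! ### Occupation time as a Carathéodory function. -/

/-- The weighted time the orbit of `x` spends in `U`, as a function that is positive on the
basin. -/
noncomputable def occupation (U : Ω → Set X) (ω : Ω) (x : X) : ENNReal :=
  ∫⁻ t in Ici (0 : ℝ), min 1 (Metric.infEDist (Φ.φ t ω x) (U (S.θ t ω))ᶜ)
    ∂(volume : Measure ℝ).toFinite

theorem measurable_occupation_integrand {α : Type*} [MeasurableSpace α] {U : Ω → Set X}
    (hU : IsRandomOpenSet U) (x : X) {f : α → ℝ} {g : α → Ω} (hf : Measurable f)
    (hg : Measurable g) :
    Measurable fun a => min 1 (Metric.infEDist (Φ.φ (f a) (g a) x) (U (S.θ (f a) (g a)))ᶜ) :=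
  measurable_const.min (hU.measurable_infEDist_compl (S.measurable_θ_comp hf hg)
    (Φ.measurable_φ_comp hf hg measurable_const))

theorem measurable_occupation {U : Ω → Set X} (hU : IsRandomOpenSet U) (x : X) :
    Measurable fun ω => Φ.occupation U ω x :=
  Measurable.lintegral_prod_right'
    (f := fun p : Ω × ℝ => min 1 (Metric.infEDist (Φ.φ p.2 p.1 x) (U (S.θ p.2 p.1))ᶜ))
    (Φ.measurable_occupation_integrand hU x measurable_snd measurable_fst)

theorem continuous_occupation {U : Ω → Set X} (hU : IsRandomOpenSet U) (ω : Ω) :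
    Continuous (Φ.occupation U ω) := by
  refine continuous_iff_continuousAt.2 fun x =>
    tendsto_lintegral_filter_of_dominated_convergence (fun _ => 1)
      (Filter.Eventually.of_forall fun y =>
        Φ.measurable_occupation_integrand hU y measurable_id measurable_const)
      (Filter.Eventually.of_forall fun y => Filter.Eventually.of_forall fun t => min_le_left _ _)
      (by simp) (Filter.Eventually.of_forall fun t => ?_)
  exact (continuous_const.min (Metric.continuous_infEDist.comp (Φ.continuous_φ t ω))).tendsto x

theorem occupation_ne_zero_iff {U : Ω → Set X} (hU : IsRandomOpenSet U) (ω : Ω) (x : X) :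
    Φ.occupation U ω x ≠ 0 ↔ 0 < volume {t | 0 ≤ t ∧ Φ.φ t ω x ∈ U (S.θ t ω)} := by
  have hm : Measurable fun t => min 1 (Metric.infEDist (Φ.φ t ω x) (U (S.θ t ω))ᶜ) :=
    Φ.measurable_occupation_integrand hU x measurable_id measurable_const
  rw [occupation, Ne, lintegral_eq_zero_iff hm, pos_iff_ne_zero,
    not_iff_not, Filter.EventuallyEq, ae_restrict_iff' measurableSet_Ici, ae_toFinite,
    measure_eq_zero_iff_ae_notMem]
  refine Filter.eventually_congr (Filter.Eventually.of_forall fun t => ?_)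
  rw [mem_ofPred_eq, ← (hU.1 _).infEDist_compl_ne_zero_iff]
  simp only [mem_Ici, Pi.zero_apply, min_eq_bot, ← bot_eq_zero, not_and, not_not]
  simp

end RDS

theorem mainTheorem10 {Ω X : Type*} [MeasurableSpace Ω] {P : Measure Ω} [IsProbabilityMeasure P]
    [MetricSpace X] [CompactSpace X] [MeasurableSpace X] [BorelSpace X]
    (S : MetricDS P) (Φ : RDS S X) (A : Ω → Set X) (hA : Φ.IsLocalAttractor A) :
    ∃ B : Ω → Set X, IsRandomOpenSet B ∧ Φ.IsInvariant B ∧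
      ∀ U : Ω → Set X, Φ.Determines U A →
        ∃ Ω₀ : Set Ω, MeasurableSet Ω₀ ∧ P Ω₀ = 1 ∧
          (∀ t ω, S.θ t ω ∈ Ω₀ ↔ ω ∈ Ω₀) ∧
          ∀ ω ∈ Ω₀, Φ.basin U ω = B ω := by
  classical
  obtain ⟨V, hV⟩ := hA
  obtain ⟨G, hGm, hGae, hG⟩ := Φ.exists_absorbing hV.1
  set R := S.recurrentSet G with hR
  have hRm : MeasurableSet R := S.measurableSet_recurrentSet hGm
  -- The value `0` off the invariant set `R` makes `B` empty there, so invariance holds for every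
  -- `ω`.
  set F : Ω → X → ENNReal := fun ω x => if ω ∈ R then Φ.occupation V ω x else 0 with hF
  have hB : ∀ ω ∈ R, {x | F ω x ≠ 0} = Φ.basin V ω := by
    intro ω hω
    ext x
    simp only [hF, if_pos hω, mem_ofPred_eq]
    rw [Φ.occupation_ne_zero_iff hV.1.1]
    refine ⟨fun h => ?_, fun h => Φ.measure_pos_of_mem_basin hG hω h 0⟩
    obtain ⟨t, ht⟩ := nonempty_of_measure_ne_zero h.ne'
    exact ⟨t, ht⟩
  have hB' : ∀ ω ∉ R, {x | F ω x ≠ 0} = ∅ := fun ω hω => by simp [hF, hω]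
  refine ⟨fun ω => {x | F ω x ≠ 0}, isRandomOpenSet_of_caratheodory (fun ω => ?_) (fun x => ?_),
    fun t ω => ?_, fun U hU => ?_⟩
  · by_cases hω : ω ∈ R
    · simpa only [hF, if_pos hω] using Φ.continuous_occupation hV.1.1 ω
    · simpa only [hF, if_neg hω] using continuous_const
  · exact Measurable.ite hRm (Φ.measurable_occupation hV.1.1 x) measurable_const
  · have hθ : S.θ t ω ∈ R ↔ ω ∈ R := S.θ_mem_recurrentSet_iff G t ω
    by_cases hω : ω ∈ R
    · simp only [hB ω hω, hB _ (hθ.2 hω)]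
      exact Φ.image_basin hG hω t
    · simp only [hB' ω hω, hB' _ (mt hθ.1 hω), image_empty]
  · obtain ⟨G', hGm', hGae', hG'⟩ := Φ.exists_absorbing hU.1
    obtain ⟨E, hEm, hEae, hE⟩ := Φ.exists_ae_absorbing hU hV
    obtain ⟨E', hEm', hEae', hE'⟩ := Φ.exists_ae_absorbing hV hU
    have hm := (hRm.inter (S.measurableSet_recurrentSet hGm')).inter
      ((S.measurableSet_recurrentSet hEm).inter (S.measurableSet_recurrentSet hEm'))
    have hae : ∀ {H : ℕ → Set Ω}, (∀ n, MeasurableSet (H n)) → (∀ᵐ ω ∂P, ∃ n, ω ∈ H n) →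
        S.recurrentSet H ∈ ae P := fun h h' =>
      (mem_ae_iff_prob_eq_one (S.measurableSet_recurrentSet h)).2 (S.measure_recurrentSet h h')
    refine ⟨_, hm, (mem_ae_iff_prob_eq_one hm).1 ?_, fun t ω => ?_, ?_⟩
    · exact Filter.inter_mem (Filter.inter_mem (hae hGm hGae) (hae hGm' hGae'))
        (Filter.inter_mem (hae hEm hEae) (hae hEm' hEae'))
    · simp only [mem_inter_iff, hR, S.θ_mem_recurrentSet_iff]
    · rintro ω ⟨⟨h1, h2⟩, h3, h4⟩
      refine Eq.trans ?_ (hB ω h1).symm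
      exact Subset.antisymm (Φ.basin_subset_basin hG' hE h2 h3)
        (Φ.basin_subset_basin hG hE' h1 h4)
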